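/- Let $c\in\mathbb R$. For $\nu>-1$ and $\operatorname{Re} w>0$ let $$I_\nu(w)=\Big(\frac w2\Big)^{\nu}\sum_{m=0}^\infty\frac{1}{m!\,\Gamma(\nu+1+m)}\Big(\frac w2\Big)^{2m}$$ be the modified Bessel function of the first kind. For $\operatorname{Re} z>0$ and $y,\rho>0$ consider the heat kernels (with respect to the Lebesgue measure $d\rho$) of the Bessel operator $B=D_{yy}+\frac cy D_y$ on $(0,\infty)$ with Dirichlet, respectively Neumann, boundary conditions at $y=0$, given explicitly by $$p_{B^d}(z,y,\rho)=\frac1{2z}\,\rho^c(y\rho)^{\frac{1-c}2}\exp\Big\{-\frac{y^2+\rho^2}{4z}\Big\}I_{\frac{1-c}2}\Big(\frac{y\rho}{2z}\Big),\qquad c<1,$$ $$p_{B^n}(z,y,\rho)=\frac1{2z}\,\rho^c(y\rho)^{\frac{1-c}2}\exp\Big\{-\frac{y^2+\rho^2}{4z}\Big\}I_{\frac{c-1}2}\Big(\frac{y\rho}{2z}\Big),\qquad c>-1.$$ Write $a\wedge b=\min\{a,b\}$ and $\Sigma_\theta=\{z\in\mathbb C\setminus\{0\}:|\arg z|\le\theta\}$.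 (1) For every $\varepsilon>0$ there exist $C,\kappa>0$, depending only on $\varepsilon$ and $c$, such that for all $z\in\Sigma_{\frac\pi2-\varepsilon}$ and all $y,\rho>0$ $$|p_{B^d}(z,y,\rho)|\le C|z|^{-\frac12}\Big(\frac y{|z|^{1/2}}\wedge1\Big)^{1-c}\Big(\frac\rho{|z|^{1/2}}\wedge1\Big)\exp\Big(-\frac{|y-\rho|^2}{\kappa|z|}\Big)\quad\text{if } c<1,$$ $$|p_{B^n}(z,y,\rho)|\le C|z|^{-\frac12}\Big(\frac\rho{|z|^{1/2}}\wedge1\Big)^{c}\exp\Big(-\frac{|y-\rho|^2}{\kappa|z|}\Big)\quad\text{if } c>-1.$$ (2) For every $\varepsilon>0$ there exist $C,\kappa>0$, depending only on $\varepsilon$ and $c$, such that for all $z\in\Sigma_{\frac\pi2-\varepsilon}$ and all $y,\rho>0$ the kernels are differentiable in $y$ and $$|D_yp_{B^d}(z,y,\rho)|\le C|z|^{-1}\Big(\frac y{|z|^{1/2}}\wedge1\Big)^{-c}\Big(\frac\rho{|z|^{1/2}}\wedge1\Big)\exp\Big(-\frac{|y-\rho|^2}{\kappa|z|}\Big)\quad\text{if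 } c<1,$$ $$|D_yp_{B^n}(z,y,\rho)|\le C|z|^{-1}\Big(\frac y{|z|^{1/2}}\wedge1\Big)\Big(\frac\rho{|z|^{1/2}}\wedge1\Big)^{c}\exp\Big(-\frac{|y-\rho|^2}{\kappa|z|}\Big)\quad\text{if } c>-1.$$ -/

import Mathlib

open scoped Nat

/-- The sector of half-opening `θ` around the positive real axis, without the origin
(and with its boundary rays, so that `θ = 0` gives the positive half line). -/
def sector (θ : ℝ) : Set ℂ :=
  {z : ℂ | z ≠ 0 ∧ |Complex.arg z| ≤ θ}

/-- The modified Bessel function of the first kind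
`I_ν(w) = (w/2)^ν ∑_{m ≥ 0} (w/2)^(2m) / (m! Γ(ν+1+m))`, with the principal power. -/
noncomputable def besselI (ν : ℝ) (w : ℂ) : ℂ :=
  (w / 2) ^ (ν : ℂ) *
    ∑' m : ℕ, (w / 2) ^ (2 * m) / ((m ! : ℂ) * (Real.Gamma (ν + 1 + m) : ℂ))

/-- The function
`(2z)⁻¹ ρ^c (yρ)^((1-c)/2) exp(-(y²+ρ²)/(4z)) I_ν(yρ/(2z))`. -/
noncomputable def besselHeatKernel (ν c : ℝ) (z : ℂ) (y ρ : ℝ) : ℂ :=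
  1 / (2 * z) * ((ρ ^ c : ℝ) : ℂ) * (((y * ρ) ^ ((1 - c) / 2) : ℝ) : ℂ) *
    Complex.exp (-((y : ℂ) ^ 2 + (ρ : ℂ) ^ 2) / (4 * z)) *
    besselI ν ((y : ℂ) * (ρ : ℂ) / (2 * z))

/-- The heat kernel, with respect to Lebesgue measure `dρ`, of the Bessel operator
`D_yy + (c/y) D_y` on the half line with Dirichlet boundary conditions (`c < 1`). -/
noncomputable def heatKernelDirichlet (c : ℝ) (z : ℂ) (y ρ : ℝ) : ℂ :=
  besselHeatKernel ((1 - c) / 2) c z y ρ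

/-- The heat kernel, with respect to Lebesgue measure `dρ`, of the Bessel operator
`D_yy + (c/y) D_y` on the half line with Neumann boundary conditions (`-1 < c`). -/
noncomputable def heatKernelNeumann (c : ℝ) (z : ℂ) (y ρ : ℝ) : ℂ :=
  besselHeatKernel ((c - 1) / 2) c z y ρ

/-!
The kernel is elementary up to the entire even function `F_ν(w) = (w/2)^(-ν) I_ν(w)`
(`besselSeries`). Everything rests on the growth of `F_ν` in a sector `δ |w| ≤ Re w`
(`besselSeriesBound`): for `ν > -1`,
`F_ν = O((1 + |w|)^(-ν-1/2) exp (Re w))` and `F_ν - F_ν' = O((1 + |w|)^(-ν-3/2) exp (Re w))`.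
For `ν > 1/2` both follow from Poisson's integral, which represents `F_ν` and `F_ν - F_ν'` as
integrals of `exp (w t)` over `[-1, 1]` against `(1 - t²)^(ν-1/2)` and `(1 - t) (1 - t²)^(ν-1/2)`
(`exists_poisson_integral`); the order of vanishing at `t = 1` gives the power of `1 + |w|`. The
recurrence `F_ν = (w/2)² F_{ν+2} + (ν+1) F_{ν+1}`, together with `F_ν' = (w/2) F_{ν+1}`, lowers the
index by one, and applied twice it reaches every `ν > -1`.

With `w = yρ/(2z)`, the factor `exp (Re w)` completes the square in the Gaussian and leaves
`exp (-δ |Y - R|²/4)`, where `Y = y/√|z|` and `R = ρ/√|z|`. Since a Gaussian absorbs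
`exp (M |Y - R|)`, one may treat `Y ∨ 1` and `R ∨ 1` as comparable, and `1 + YR/2` as comparable to
their product; this turns `R^s Y^t (1 + YR/2)^(-(s+t)/2)` into `(R ∧ 1)^s (Y ∧ 1)^t`
(`rpow_mul_rpow_mul_rpow_le`).

In the `y`-derivative the combination `-y F + ρ F'` appears. Written as
`(ρ - y) F - ρ (F - F')` it shows the cancellation for `Y ≥ 1`; for `Y ≤ 1` the factor
`F' = (w/2) F_{ν+1}` supplies the power of `y` (`norm_neg_mul_add_mul_le`).
-/

/-! ### The entire function `(w / 2) ^ (-ν) I_ν(w)` -/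

/-- The entire even factor `∑ₘ (w/2)^(2m) / (m! Γ(ν+1+m))` of the modified Bessel function, so that
`I_ν(w) = (w/2)^ν * besselSeries ν w`. -/
noncomputable def besselSeries (ν : ℝ) (w : ℂ) : ℂ :=
  ∑' m : ℕ, (w / 2) ^ (2 * m) / ((m ! : ℂ) * (Real.Gamma (ν + 1 + m) : ℂ))

lemma exists_pos_le_Gamma_add_natCast {ν : ℝ} (hν : -1 < ν) :
    ∃ K > 0, ∀ m : ℕ, K ≤ Real.Gamma (ν + 1 + m) := by
  have h1 : 0 < Real.Gamma (ν + 1) := Real.Gamma_pos_of_pos (by linarith)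
  have h2 : 0 < Real.Gamma (ν + 2) := Real.Gamma_pos_of_pos (by linarith)
  -- From `m = 1` on, the sequence is increasing, since the factors `ν + 1 + m` are at least `1`.
  have key : ∀ m : ℕ, Real.Gamma (ν + 2) ≤ Real.Gamma (ν + 1 + (m + 1 : ℕ)) := by
    intro m
    induction m with
    | zero => apply le_of_eq; congr 1; push_cast; ring
    | succ m ih =>
      have hpos : 0 < Real.Gamma (ν + 1 + (m + 1 : ℕ)) := h2.trans_le ih
      have hm : (0 : ℝ) ≤ m := m.cast_nonneg
      have e : ν + 1 + ((m + 1 + 1 : ℕ) : ℝ) = (ν + 1 + (m + 1 : ℕ)) + 1 := by push_cast; ring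
      rw [e, Real.Gamma_add_one (by push_cast; linarith)]
      push_cast at *
      nlinarith
  refine ⟨min (Real.Gamma (ν + 1)) (Real.Gamma (ν + 2)), lt_min h1 h2, fun m => ?_⟩
  cases m with
  | zero => simp
  | succ m => exact (min_le_right _ _).trans (key m)

lemma exists_norm_besselSeries_term_le {ν : ℝ} (hν : -1 < ν) :
    ∃ K > 0, ∀ (w : ℂ) (m : ℕ),
      ‖(w / 2) ^ (2 * m) / ((m ! : ℂ) * (Real.Gamma (ν + 1 + m) : ℂ))‖ ≤
        K * ((‖w / 2‖ ^ 2) ^ m / m !) := by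
  obtain ⟨K, hK, h⟩ := exists_pos_le_Gamma_add_natCast hν
  refine ⟨K⁻¹, by positivity, fun w m => ?_⟩
  have hG := hK.trans_le (h m)
  rw [norm_div, norm_mul, norm_pow, Complex.norm_natCast, Complex.norm_real, Real.norm_eq_abs,
    abs_of_pos hG, pow_mul]
  calc (‖w / 2‖ ^ 2) ^ m / (m ! * Real.Gamma (ν + 1 + m))
      ≤ (‖w / 2‖ ^ 2) ^ m / (m ! * K) := by gcongr; exact h m
    _ = _ := by field_simp

lemma summable_besselSeries {ν : ℝ} (hν : -1 < ν) (w : ℂ) :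
    Summable fun m : ℕ => (w / 2) ^ (2 * m) / ((m ! : ℂ) * (Real.Gamma (ν + 1 + m) : ℂ)) := by
  obtain ⟨K, -, h⟩ := exists_norm_besselSeries_term_le hν
  exact Summable.of_norm_bounded ((Real.summable_pow_div_factorial _).mul_left K) (h w)

lemma besselSeries_eq_zero_add {ν : ℝ} (hν : -1 < ν) (w : ℂ) :
    besselSeries ν w = 1 / (Real.Gamma (ν + 1) : ℂ) +
      ∑' m : ℕ, (w / 2) ^ (2 * (m + 1)) /
        (((m + 1) ! : ℂ) * (Real.Gamma (ν + 1 + (m + 1 : ℕ)) : ℂ)) := by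
  rw [besselSeries, (summable_besselSeries hν w).tsum_eq_zero_add]
  simp

lemma hasDerivAt_besselSeries {ν : ℝ} (hν : -1 < ν) (w : ℂ) :
    HasDerivAt (besselSeries ν) (w / 2 * besselSeries (ν + 1) w) w := by
  obtain ⟨K, hK, h⟩ := exists_norm_besselSeries_term_le (ν := ν + 1) (by linarith)
  set r := ‖w‖ + 1
  have hw : w ∈ Metric.ball (0 : ℂ) r := by simp [r]
  have hderiv : HasDerivAt (fun z : ℂ => ∑' m : ℕ, (z / 2) ^ (2 * (m + 1)) /
        (((m + 1) ! : ℂ) * (Real.Gamma (ν + 1 + (m + 1 : ℕ)) : ℂ)))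
      (∑' m : ℕ, w / 2 * ((w / 2) ^ (2 * m) /
        ((m ! : ℂ) * (Real.Gamma (ν + 1 + 1 + m) : ℂ)))) w := by
    refine hasDerivAt_tsum_of_isPreconnected
      (g := fun (m : ℕ) (z : ℂ) => (z / 2) ^ (2 * (m + 1)) /
        (((m + 1) ! : ℂ) * (Real.Gamma (ν + 1 + (m + 1 : ℕ)) : ℂ)))
      (g' := fun (m : ℕ) (z : ℂ) => z / 2 * ((z / 2) ^ (2 * m) /
        ((m ! : ℂ) * (Real.Gamma (ν + 1 + 1 + m) : ℂ))))
      (u := fun m => r / 2 * (K * (((r / 2) ^ 2) ^ m / m !)))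
      (((Real.summable_pow_div_factorial _).mul_left K).mul_left _) Metric.isOpen_ball
      (convex_ball (0 : ℂ) r).isPreconnected ?_ ?_ hw
      ((summable_nat_add_iff 1).2 (summable_besselSeries hν w)) hw
    · intro m z _
      have e : ν + 1 + ((m + 1 : ℕ) : ℝ) = ν + 1 + 1 + m := by push_cast; ring
      have hG : (Real.Gamma (ν + 1 + 1 + m) : ℂ) ≠ 0 := by
        have : (0 : ℝ) ≤ m := m.cast_nonneg
        exact_mod_cast (Real.Gamma_pos_of_pos (by linarith)).ne'
      refine ((((hasDerivAt_id z).div_const 2).pow (2 * (m + 1))).div_const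
        (((m + 1) ! : ℂ) * (Real.Gamma (ν + 1 + (m + 1 : ℕ)) : ℂ))).congr_deriv ?_
      rw [e, Nat.factorial_succ, show 2 * (m + 1) - 1 = 2 * m + 1 by omega]
      push_cast
      simp only [id]
      field_simp
      rw [pow_succ]
      ring
    · intro m z hz
      have hz' : ‖z / 2‖ ≤ r / 2 := by
        rw [norm_div, Complex.norm_two]
        have := mem_ball_zero_iff.1 hz
        gcongr
      rw [norm_mul]
      refine mul_le_mul hz' ((h z m).trans ?_) (norm_nonneg _) (by positivity)
      gcongr
  rw [tsum_mul_left] at hderiv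
  refine (hderiv.const_add (1 / (Real.Gamma (ν + 1) : ℂ))).congr_of_eventuallyEq ?_
  exact Filter.Eventually.of_forall fun z => besselSeries_eq_zero_add hν z

/-- The recurrence `I_ν(w) = I_{ν+2}(w) + 2 (ν+1) w⁻¹ I_{ν+1}(w)`, divided by `(w/2)^ν`. -/
lemma besselSeries_recurrence {ν : ℝ} (hν : -1 < ν) (w : ℂ) :
    besselSeries ν w =
      (w / 2) ^ 2 * besselSeries (ν + 2) w + (ν + 1) * besselSeries (ν + 1) w := by
  rw [besselSeries_eq_zero_add hν, besselSeries_eq_zero_add (ν := ν + 1) (by linarith),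
    besselSeries, mul_add, ← tsum_mul_left, ← tsum_mul_left]
  have s2 := (summable_besselSeries (ν := ν + 2) (by linarith) w).mul_left ((w / 2) ^ 2)
  have s1 := ((summable_nat_add_iff 1).2
    (summable_besselSeries (ν := ν + 1) (by linarith) w)).mul_left ((ν : ℂ) + 1)
  rw [add_left_comm, ← s2.tsum_add s1]
  have hp : ν + 1 ≠ 0 := by linarith
  have hp' : (ν : ℂ) + 1 ≠ 0 := by exact_mod_cast hp
  have hG0 : (Real.Gamma (ν + 1) : ℂ) ≠ 0 := by
    exact_mod_cast (Real.Gamma_pos_of_pos (by linarith)).ne'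
  congr 1
  · rw [Real.Gamma_add_one hp]
    push_cast
    field_simp
  · refine tsum_congr fun m => ?_
    have hq : ν + 2 + m ≠ 0 := by linarith
    have hq' : (ν : ℂ) + 2 + m ≠ 0 := by exact_mod_cast hq
    have hG : (Real.Gamma (ν + 2 + m) : ℂ) ≠ 0 := by
      exact_mod_cast (Real.Gamma_pos_of_pos (by linarith)).ne'
    have e1 : ν + 1 + ((m + 1 : ℕ) : ℝ) = ν + 2 + m := by push_cast; ring
    have e2 : ν + 2 + 1 + (m : ℝ) = ν + 2 + m + 1 := by ring
    have e3 : ν + 1 + 1 + ((m + 1 : ℕ) : ℝ) = ν + 2 + m + 1 := by push_cast; ring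
    rw [e1, e2, e3, Real.Gamma_add_one hq, Nat.factorial_succ]
    push_cast
    field_simp
    ring

/-! ### Poisson's integral -/

lemma integral_eq_zero_of_odd {f : ℝ → ℝ} (hf : ∀ t, f (-t) = -f t) (r : ℝ) :
    ∫ t in (-r)..r, f t = 0 := by
  have h := intervalIntegral.integral_comp_neg (a := -r) (b := r) f
  simp only [hf, intervalIntegral.integral_neg, neg_neg] at h
  linarith

lemma continuous_one_sub_sq_rpow {a : ℝ} (ha : 0 ≤ a) :
    Continuous fun t : ℝ => (1 - t ^ 2) ^ a :=
  (by fun_prop : Continuous fun t : ℝ => 1 - t ^ 2).rpow_const fun _ => Or.inr ha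

/-- Integration by parts in the moments of the weight `(1 - t²)^a` on `[-1, 1]`. -/
lemma integral_pow_mul_one_sub_sq_rpow {a : ℝ} (ha : 0 < a) (m : ℕ) :
    (2 * m + 1) * ∫ t in (-1 : ℝ)..1, t ^ (2 * m) * (1 - t ^ 2) ^ a =
      (2 * m + 3 + 2 * a) * ∫ t in (-1 : ℝ)..1, t ^ (2 * (m + 1)) * (1 - t ^ 2) ^ a := by
  have hc := continuous_one_sub_sq_rpow ha.le
  have key : ∫ t in (-1 : ℝ)..1, ((2 * m + 1) * (t ^ (2 * m) * (1 - t ^ 2) ^ a) -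
      (2 * m + 3 + 2 * a) * (t ^ (2 * (m + 1)) * (1 - t ^ 2) ^ a)) = 0 := by
    have := intervalIntegral.integral_eq_sub_of_hasDerivAt (a := -1) (b := 1)
      (f := fun t : ℝ => t ^ (2 * m + 1) * (1 - t ^ 2) ^ (a + 1))
      (f' := fun t => (2 * m + 1) * (t ^ (2 * m) * (1 - t ^ 2) ^ a) -
        (2 * m + 3 + 2 * a) * (t ^ (2 * (m + 1)) * (1 - t ^ 2) ^ a)) ?_
        ((by fun_prop : Continuous _).intervalIntegrable _ _)
    · rw [this]
      simp [Real.zero_rpow (by linarith : a + 1 ≠ 0)]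
    · intro t ht
      rw [Set.uIcc_of_le (by norm_num)] at ht
      have h0 : 0 ≤ 1 - t ^ 2 := by nlinarith [ht.1, ht.2]
      have h1 : HasDerivAt (fun t : ℝ => (1 - t ^ 2)) (-(2 * t)) t := by
        simpa using ((hasDerivAt_id t).pow 2).const_sub 1
      have h2 := h1.rpow_const (p := a + 1) (Or.inr (by linarith))
      refine ((hasDerivAt_pow (2 * m + 1) t).mul h2).congr_deriv ?_
      rw [add_sub_cancel_right, Real.rpow_add_one' h0 (by linarith)]
      push_cast
      ring
  rw [intervalIntegral.integral_sub, intervalIntegral.integral_const_mul,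
    intervalIntegral.integral_const_mul] at key
  · linarith
  all_goals exact (by fun_prop : Continuous _).intervalIntegrable _ _

/-- The even moments of the Poisson weight are, up to one constant, the coefficients of the Bessel
series. -/
lemma integral_pow_mul_one_sub_sq_rpow_div_factorial {ν : ℝ} (hν : 1 / 2 < ν) (m : ℕ) :
    (∫ t in (-1 : ℝ)..1, t ^ (2 * m) * (1 - t ^ 2) ^ (ν - 1 / 2)) / (2 * m) ! =
      (∫ t in (-1 : ℝ)..1, (1 - t ^ 2) ^ (ν - 1 / 2)) * Real.Gamma (ν + 1) *
        ((1 / 4) ^ m / (m ! * Real.Gamma (ν + 1 + m))) := by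
  induction m with
  | zero =>
    have : Real.Gamma (ν + 1) ≠ 0 := (Real.Gamma_pos_of_pos (by linarith)).ne'
    simp
    field_simp
  | succ m ih =>
    have h := integral_pow_mul_one_sub_sq_rpow (a := ν - 1 / 2) (by linarith) m
    have hG : Real.Gamma (ν + 1 + m) ≠ 0 := (Real.Gamma_pos_of_pos (by linarith)).ne'
    have hq : ν + 1 + m ≠ 0 := by linarith
    have e1 : ν + 1 + ((m + 1 : ℕ) : ℝ) = ν + 1 + m + 1 := by push_cast; ring
    have e2 : 2 * (m + 1) = 2 * m + 1 + 1 := by ring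
    set A := ∫ t in (-1 : ℝ)..1, t ^ (2 * m) * (1 - t ^ 2) ^ (ν - 1 / 2)
    set B := ∫ t in (-1 : ℝ)..1, t ^ (2 * (m + 1)) * (1 - t ^ 2) ^ (ν - 1 / 2)
    set M := ∫ t in (-1 : ℝ)..1, (1 - t ^ 2) ^ (ν - 1 / 2)
    have hB : B = (2 * m + 1) / (2 * (ν + 1 + m)) * A := by
      field_simp
      linarith
    have hA : A = M * Real.Gamma (ν + 1) *
        ((1 / 4) ^ m / (m ! * Real.Gamma (ν + 1 + m))) * (2 * m) ! := by
      rw [← ih]; field_simp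
    rw [e1, Real.Gamma_add_one hq, hB, hA, e2, Nat.factorial_succ, Nat.factorial_succ,
      Nat.factorial_succ, pow_succ]
    push_cast
    field_simp
    ring

/-- Termwise integration of the exponential series against a continuous density. -/
lemma hasSum_integral_mul_exp {f : ℝ → ℝ} (hf : Continuous f) (w : ℂ) :
    HasSum (fun k : ℕ => w ^ k / k ! * ((∫ t in (-1 : ℝ)..1, t ^ k * f t : ℝ) : ℂ))
      (∫ t in (-1 : ℝ)..1, (f t : ℂ) * Complex.exp (w * t)) := by
  have h := intervalIntegral.hasSum_integral_of_dominated_convergence (a := -1) (b := 1)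
    (μ := MeasureTheory.volume) (F := fun (k : ℕ) (t : ℝ) => w ^ k / k ! * ((t ^ k * f t : ℝ) : ℂ))
    (f := fun t : ℝ => (f t : ℂ) * Complex.exp (w * t))
    (fun k t => ‖w‖ ^ k / k ! * |f t|) ?_ ?_ ?_ ?_ ?_
  · simpa only [intervalIntegral.integral_const_mul, intervalIntegral.integral_ofReal] using h
  · intro k
    exact (by fun_prop : Continuous _).aestronglyMeasurable
  · intro k
    refine Filter.Eventually.of_forall fun t ht => ?_
    rw [Set.uIoc_of_le (by norm_num)] at ht
    have h1 : |t| ^ k ≤ 1 := pow_le_one₀ (abs_nonneg t) (abs_le.2 ⟨ht.1.le, ht.2⟩)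
    rw [norm_mul, norm_div, norm_pow, Complex.norm_natCast, Complex.norm_real, norm_mul, norm_pow,
      Real.norm_eq_abs, Real.norm_eq_abs]
    gcongr
    exact mul_le_of_le_one_left (abs_nonneg _) h1
  · exact Filter.Eventually.of_forall fun t _ => (Real.summable_pow_div_factorial _).mul_right _
  · simp_rw [tsum_mul_right]
    exact (by fun_prop : Continuous _).intervalIntegrable _ _
  · refine Filter.Eventually.of_forall fun t _ => ?_
    have := (NormedSpace.expSeries_div_hasSum_exp (w * (t : ℂ))).mul_left (f t : ℂ)
    rw [← Complex.exp_eq_exp_ℂ] at this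
    refine this.congr_fun fun k => ?_
    push_cast
    rw [mul_pow]
    ring

/-- Poisson's integral for `I_ν` and for its analogue with a factor `t`, which is the derivative. -/
lemma exists_poisson_integral {ν : ℝ} (hν : 1 / 2 < ν) :
    ∃ K > 0, ∀ w : ℂ,
      (∫ t in (-1 : ℝ)..1, (((1 - t ^ 2) ^ (ν - 1 / 2) : ℝ) : ℂ) * Complex.exp (w * t)) =
        (K : ℝ) * besselSeries ν w ∧
      (∫ t in (-1 : ℝ)..1, ((t * (1 - t ^ 2) ^ (ν - 1 / 2) : ℝ) : ℂ) * Complex.exp (w * t)) =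
        (K : ℝ) * (w / 2 * besselSeries (ν + 1) w) := by
  have hc := continuous_one_sub_sq_rpow (a := ν - 1 / 2) (by linarith)
  have hM : 0 < ∫ t in (-1 : ℝ)..1, (1 - t ^ 2) ^ (ν - 1 / 2) := by
    refine intervalIntegral.intervalIntegral_pos_of_pos_on (hc.intervalIntegrable _ _) ?_
      (by norm_num)
    intro t ht
    exact Real.rpow_pos_of_pos (by nlinarith [ht.1, ht.2]) _
  refine ⟨(∫ t in (-1 : ℝ)..1, (1 - t ^ 2) ^ (ν - 1 / 2)) * Real.Gamma (ν + 1),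
    mul_pos hM (Real.Gamma_pos_of_pos (by linarith)), fun w => ⟨?_, ?_⟩⟩
  · have h := hasSum_integral_mul_exp hc w
    have hinj : Function.Injective fun m : ℕ => 2 * m := fun a b h => by simpa using h
    rw [← hinj.hasSum_iff] at h
    · rw [← h.tsum_eq, besselSeries, ← tsum_mul_left]
      refine tsum_congr fun m => ?_
      have := integral_pow_mul_one_sub_sq_rpow_div_factorial hν m
      simp only [Function.comp]
      rw [div_mul_eq_mul_div, mul_div_assoc, ← Complex.ofReal_natCast, ← Complex.ofReal_div, this]
      push_cast
      rw [show (w / 2) ^ (2 * m) = w ^ (2 * m) * (1 / 4) ^ m by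
        rw [div_pow, pow_mul 2 2 m, one_div, inv_pow, div_eq_mul_inv]; norm_num]
      ring
    · intro k hk
      have hodd : Odd k := Nat.not_even_iff_odd.1 fun ⟨j, hj⟩ => hk ⟨j, by simp; omega⟩
      rw [integral_eq_zero_of_odd (fun t => by rw [hodd.neg_pow, neg_sq]; ring)]
      simp
  · have h := hasSum_integral_mul_exp (f := fun t => t * (1 - t ^ 2) ^ (ν - 1 / 2))
      (continuous_id.mul hc) w
    have hinj : Function.Injective fun m : ℕ => 2 * m + 1 := fun a b h => by simpa using h
    rw [← hinj.hasSum_iff] at h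
    · rw [← h.tsum_eq, besselSeries, ← tsum_mul_left, ← tsum_mul_left]
      refine tsum_congr fun m => ?_
      have := integral_pow_mul_one_sub_sq_rpow_div_factorial hν (m + 1)
      have e : ν + 1 + ((m + 1 : ℕ) : ℝ) = ν + 1 + 1 + m := by push_cast; ring
      have hI : (∫ t in (-1 : ℝ)..1, t ^ (2 * m + 1) * (t * (1 - t ^ 2) ^ (ν - 1 / 2))) =
          ∫ t in (-1 : ℝ)..1, t ^ (2 * (m + 1)) * (1 - t ^ 2) ^ (ν - 1 / 2) := by
        congr 1; ext t; ring
      have hG : Real.Gamma (ν + 1 + 1 + m) ≠ 0 := (Real.Gamma_pos_of_pos (by linarith)).ne'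
      have h2 : (∫ t in (-1 : ℝ)..1, t ^ (2 * (m + 1)) * (1 - t ^ 2) ^ (ν - 1 / 2)) /
          (2 * m + 1) ! = (∫ t in (-1 : ℝ)..1, (1 - t ^ 2) ^ (ν - 1 / 2)) * Real.Gamma (ν + 1) *
            ((1 / 4) ^ m / 2 / (m ! * Real.Gamma (ν + 1 + 1 + m))) := by
        rw [e, show (2 * (m + 1)) ! = (2 * m + 2) * (2 * m + 1) ! from Nat.factorial_succ _,
          Nat.factorial_succ m, pow_succ] at this
        push_cast at this
        field_simp at this ⊢
        linarith
      simp only [Function.comp]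
      rw [hI, div_mul_eq_mul_div, mul_div_assoc, ← Complex.ofReal_natCast, ← Complex.ofReal_div, h2]
      push_cast
      rw [show (w / 2) ^ (2 * m) = w ^ (2 * m) * (1 / 4) ^ m by
        rw [div_pow, pow_mul 2 2 m, one_div, inv_pow, div_eq_mul_inv]; norm_num]
      ring
    · intro k hk
      have heven : Even k := Nat.not_odd_iff_even.1 fun ⟨j, hj⟩ => hk ⟨j, by simp; omega⟩
      rw [integral_eq_zero_of_odd (fun t => by rw [heven.neg_pow, neg_sq]; ring)]
      simp

/-! ### Growth of the Bessel series in a sector -/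

/-- Watson's lemma for the endpoint `t = 1`, uniformly in `x ≥ 0`. -/
lemma integral_one_sub_rpow_mul_exp_le {s x : ℝ} (hs : 0 ≤ s) (hx : 0 ≤ x) :
    ∫ t in (-1 : ℝ)..1, (1 - t) ^ s * Real.exp (x * t) ≤
      Real.exp 2 * Real.Gamma (s + 1) * (1 + x) ^ (-(s + 1)) * Real.exp x := by
  have hx1 : 0 < 1 + x := by linarith
  have hsub : ∫ t in (-1 : ℝ)..1, (1 - t) ^ s * Real.exp (x * t) =
      ∫ u in (0 : ℝ)..2, u ^ s * Real.exp (x * (1 - u)) := by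
    have := intervalIntegral.integral_comp_sub_left (a := -1) (b := 1)
      (fun u : ℝ => u ^ s * Real.exp (x * (1 - u))) 1
    simp only [sub_sub_cancel, sub_self] at this
    rw [this]
    norm_num
  have hint : MeasureTheory.IntegrableOn (fun u : ℝ => u ^ s * Real.exp (-((1 + x) * u)))
      (Set.Ioi 0) := by
    have := integrableOn_rpow_mul_exp_neg_mul_rpow (p := 1) (s := s) (b := 1 + x)
      (by linarith) one_pos hx1
    simpa only [Real.rpow_one, neg_mul] using this
  have hval := Real.integral_rpow_mul_exp_neg_mul_Ioi (a := s + 1) (by linarith) hx1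
  rw [add_sub_cancel_right] at hval
  have hcs : Continuous fun u : ℝ => u ^ s := continuous_id.rpow_const fun _ => Or.inr hs
  calc ∫ t in (-1 : ℝ)..1, (1 - t) ^ s * Real.exp (x * t)
      = ∫ u in (0 : ℝ)..2, u ^ s * Real.exp (x * (1 - u)) := hsub
    _ ≤ ∫ u in (0 : ℝ)..2, Real.exp 2 * Real.exp x * (u ^ s * Real.exp (-((1 + x) * u))) := by
        refine intervalIntegral.integral_mono_on (by norm_num)
          ((by fun_prop : Continuous _).intervalIntegrable _ _)
          ((by fun_prop : Continuous _).intervalIntegrable _ _) fun u hu => ?_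
        rw [mul_left_comm, ← Real.exp_add, ← Real.exp_add]
        have := Real.rpow_nonneg hu.1 s
        gcongr
        nlinarith [hu.2]
    _ = Real.exp 2 * Real.exp x * ∫ u in Set.Ioc (0 : ℝ) 2, u ^ s * Real.exp (-((1 + x) * u)) := by
        rw [intervalIntegral.integral_const_mul, intervalIntegral.integral_of_le (by norm_num)]
    _ ≤ Real.exp 2 * Real.exp x * ∫ u in Set.Ioi (0 : ℝ), u ^ s * Real.exp (-((1 + x) * u)) := by
        refine mul_le_mul_of_nonneg_left ?_ (by positivity)
        refine MeasureTheory.setIntegral_mono_set hint ?_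
          (Filter.Eventually.of_forall fun u hu => hu.1)
        refine (MeasureTheory.ae_restrict_iff' measurableSet_Ioi).2
          (Filter.Eventually.of_forall fun u hu => ?_)
        exact mul_nonneg (Real.rpow_nonneg (le_of_lt hu) _) (Real.exp_pos _).le
    _ = _ := by
        rw [hval, one_div, Real.inv_rpow hx1.le, ← Real.rpow_neg hx1.le]
        ring

/-- The bound of the integral of `f t * exp (w * t)` for a density that vanishes to order `s` at
`t = 1`, in the sector where `Re w` controls `‖w‖`. -/
lemma norm_integral_mul_exp_le {f : ℝ → ℝ} {A s δ : ℝ} (hA : 0 ≤ A) (hs : 0 ≤ s)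
    (hδ : 0 < δ) (hδ1 : δ ≤ 1) (hf : ∀ t ∈ Set.Icc (-1 : ℝ) 1, |f t| ≤ A * (1 - t) ^ s) :
    ∃ C > 0, ∀ w : ℂ, δ * ‖w‖ ≤ w.re →
      ‖∫ t in (-1 : ℝ)..1, (f t : ℂ) * Complex.exp (w * t)‖ ≤
        C * (1 + ‖w‖) ^ (-(s + 1)) * Real.exp w.re := by
  have hG : 0 < Real.Gamma (s + 1) := Real.Gamma_pos_of_pos (by linarith)
  refine ⟨(A + 1) * (Real.exp 2 * Real.Gamma (s + 1) * δ ^ (-(s + 1))),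
    by positivity, fun w hw => ?_⟩
  have hx : 0 ≤ w.re := (by positivity : 0 ≤ δ * ‖w‖).trans hw
  have hcs : Continuous fun t : ℝ => (1 - t) ^ s :=
    (by fun_prop : Continuous fun t : ℝ => 1 - t).rpow_const fun _ => Or.inr hs
  have h1 : ‖∫ t in (-1 : ℝ)..1, (f t : ℂ) * Complex.exp (w * t)‖ ≤
      ∫ t in (-1 : ℝ)..1, A * ((1 - t) ^ s * Real.exp (w.re * t)) := by
    refine intervalIntegral.norm_integral_le_of_norm_le (by norm_num)
      (Filter.Eventually.of_forall fun t ht => ?_)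
      ((by fun_prop : Continuous _).intervalIntegrable _ _)
    rw [norm_mul, Complex.norm_real, Complex.norm_exp, Complex.re_mul_ofReal, Real.norm_eq_abs,
      ← mul_assoc]
    gcongr
    exact hf t ⟨ht.1.le, ht.2⟩
  rw [intervalIntegral.integral_const_mul] at h1
  have h2 := integral_one_sub_rpow_mul_exp_le hs hx
  have h3 : (1 + w.re) ^ (-(s + 1)) ≤ δ ^ (-(s + 1)) * (1 + ‖w‖) ^ (-(s + 1)) := by
    rw [← Real.mul_rpow hδ.le (by positivity)]
    refine Real.rpow_le_rpow_of_nonpos (by positivity) ?_ (by linarith)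
    linarith
  have h4 : 0 ≤ ∫ t in (-1 : ℝ)..1, (1 - t) ^ s * Real.exp (w.re * t) :=
    intervalIntegral.integral_nonneg (by norm_num) fun t ht =>
      mul_nonneg (Real.rpow_nonneg (by linarith [ht.2]) _) (Real.exp_pos _).le
  calc _ ≤ A * ∫ t in (-1 : ℝ)..1, (1 - t) ^ s * Real.exp (w.re * t) := h1
    _ ≤ (A + 1) * ∫ t in (-1 : ℝ)..1, (1 - t) ^ s * Real.exp (w.re * t) := by gcongr; linarith
    _ ≤ (A + 1) * (Real.exp 2 * Real.Gamma (s + 1) * (1 + w.re) ^ (-(s + 1)) * Real.exp w.re) := by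
        gcongr
    _ ≤ (A + 1) * (Real.exp 2 * Real.Gamma (s + 1) *
          (δ ^ (-(s + 1)) * (1 + ‖w‖) ^ (-(s + 1))) * Real.exp w.re) := by gcongr
    _ = _ := by ring

/-- The growth, in the sector `δ ‖w‖ ≤ Re w`, of the Bessel series `F` and of `F - F'`; the
difference is smaller by a factor `1 + ‖w‖`. The derivative `F'` is written as
`(w/2) F_{ν+1}`. -/
def BesselSeriesBound (δ ν : ℝ) : Prop :=
  ∃ C > 0, ∀ w : ℂ, δ * ‖w‖ ≤ w.re →
    ‖besselSeries ν w‖ ≤ C * (1 + ‖w‖) ^ (-(ν + 1 / 2)) * Real.exp w.re ∧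
    ‖besselSeries ν w - w / 2 * besselSeries (ν + 1) w‖ ≤
      C * (1 + ‖w‖) ^ (-(ν + 3 / 2)) * Real.exp w.re

/-- For `ν > 1/2` the bound is read off Poisson's integral: passing from `F` to `F - F'` inserts a
factor `1 - t`. -/
lemma besselSeriesBound_of_half_lt {δ ν : ℝ} (hδ : 0 < δ) (hδ1 : δ ≤ 1) (hν : 1 / 2 < ν) :
    BesselSeriesBound δ ν := by
  obtain ⟨K, hK, hP⟩ := exists_poisson_integral hν
  have hc := continuous_one_sub_sq_rpow (a := ν - 1 / 2) (by linarith)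
  have hw : ∀ t ∈ Set.Icc (-1 : ℝ) 1,
      |(1 - t ^ 2) ^ (ν - 1 / 2)| ≤ 2 ^ (ν - 1 / 2) * (1 - t) ^ (ν - 1 / 2) := by
    intro t ht
    have h1 : 0 ≤ 1 - t := by linarith [ht.2]
    have h2 : 0 ≤ 1 + t := by linarith [ht.1]
    have h3 : 0 ≤ 1 - t ^ 2 := by nlinarith
    rw [abs_of_nonneg (Real.rpow_nonneg h3 _), ← Real.mul_rpow (by norm_num) h1]
    exact Real.rpow_le_rpow h3 (by nlinarith [ht.2]) (by linarith)
  obtain ⟨C₁, hC₁, h₁⟩ := norm_integral_mul_exp_le (s := ν - 1 / 2)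
    (by positivity) (by linarith) hδ hδ1 hw
  obtain ⟨C₂, hC₂, h₂⟩ := norm_integral_mul_exp_le (s := ν + 1 / 2) (A := 2 ^ (ν - 1 / 2))
    (f := fun t => (1 - t) * (1 - t ^ 2) ^ (ν - 1 / 2)) (by positivity) (by linarith) hδ hδ1 (by
      intro t ht
      have h1 : 0 ≤ 1 - t := by linarith [ht.2]
      rw [abs_mul, abs_of_nonneg h1, show ν + 1 / 2 = (ν - 1 / 2) + 1 by ring,
        Real.rpow_add_one' h1 (by linarith)]
      calc _ ≤ (1 - t) * (2 ^ (ν - 1 / 2) * (1 - t) ^ (ν - 1 / 2)) := by gcongr; exact hw t ht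
        _ = _ := by ring)
  have hKn : ‖((K : ℝ) : ℂ)‖ = K := by rw [Complex.norm_real, Real.norm_of_nonneg hK.le]
  refine ⟨K⁻¹ * (C₁ + C₂), by positivity, fun w hδw => ⟨?_, ?_⟩⟩
  · have h := h₁ w hδw
    rw [(hP w).1, norm_mul, hKn, show ν - 1 / 2 + 1 = ν + 1 / 2 by ring] at h
    rw [mul_assoc, mul_assoc, le_inv_mul_iff₀ hK, ← mul_assoc]
    refine h.trans ?_
    gcongr
    linarith
  · have h := h₂ w hδw
    have hI : (∫ t in (-1 : ℝ)..1, (((1 - t) * (1 - t ^ 2) ^ (ν - 1 / 2) : ℝ) : ℂ) *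
        Complex.exp (w * t)) =
        (K : ℝ) * (besselSeries ν w - w / 2 * besselSeries (ν + 1) w) := by
      rw [mul_sub, ← (hP w).1, ← (hP w).2, ← intervalIntegral.integral_sub]
      · congr 1
        ext t
        push_cast
        ring
      all_goals exact (by fun_prop : Continuous _).intervalIntegrable _ _
    rw [hI, norm_mul, hKn, show ν + 1 / 2 + 1 = ν + 3 / 2 by ring] at h
    rw [mul_assoc, mul_assoc, le_inv_mul_iff₀ hK, ← mul_assoc]
    refine h.trans ?_
    gcongr
    linarith

/-- The recurrence lowers the index: `F_ν = (w/2) F'_{ν+1} + (ν+1) F_{ν+1}`, and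
`F_ν - F'_ν = (ν+1) F_{ν+1} - (w/2) (F_{ν+1} - F'_{ν+1})`. -/
lemma BesselSeriesBound.of_add_one {δ ν : ℝ} (hν : -1 < ν) (h : BesselSeriesBound δ (ν + 1)) :
    BesselSeriesBound δ ν := by
  obtain ⟨C, hC, h⟩ := h
  refine ⟨(ν + 3) * C, by nlinarith, fun w hw => ?_⟩
  obtain ⟨h1, h2⟩ := h w hw
  have hrec := besselSeries_recurrence hν w
  rw [show ν + 1 + 1 = ν + 2 by ring] at h2
  have hq : 0 < 1 + ‖w‖ := by positivity
  have hw2 : ‖w / 2‖ ≤ 1 + ‖w‖ := by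
    rw [norm_div, Complex.norm_two]; linarith [norm_nonneg w]
  have hν1 : ‖(ν : ℂ) + 1‖ = ν + 1 := by
    rw [← Complex.ofReal_one, ← Complex.ofReal_add, Complex.norm_real,
      Real.norm_of_nonneg (by linarith)]
  set F₁ := besselSeries (ν + 1) w
  set F₂ := besselSeries (ν + 2) w
  set q := 1 + ‖w‖
  set E := Real.exp w.re
  have e1 : q ^ (-(ν + 1 / 2)) = q * q ^ (-(ν + 3 / 2)) := by
    rw [show -(ν + 1 / 2) = -(ν + 3 / 2) + 1 by ring, Real.rpow_add_one hq.ne']; ring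
  have e2 : q ^ (-(ν + 3 / 2)) = q * q ^ (-(ν + 5 / 2)) := by
    rw [show -(ν + 3 / 2) = -(ν + 5 / 2) + 1 by ring, Real.rpow_add_one hq.ne']; ring
  rw [show ν + 1 + 1 / 2 = ν + 3 / 2 by ring] at h1
  rw [show ν + 1 + 3 / 2 = ν + 5 / 2 by ring] at h2
  have hq1 : 1 ≤ q := by simp [q]
  set Q := q ^ (-(ν + 3 / 2))
  set Q' := q ^ (-(ν + 5 / 2))
  have hQ' : 0 < Q' := Real.rpow_pos_of_pos hq _
  have hd : ‖w / 2 * (F₁ - w / 2 * F₂)‖ ≤ C * Q * E := by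
    rw [norm_mul, e2]
    calc _ ≤ q * (C * Q' * E) := by gcongr
      _ = _ := by ring
  have hm : ‖((ν : ℂ) + 1) * F₁‖ ≤ (ν + 1) * (C * Q * E) := by
    rw [norm_mul, hν1]
    have : 0 ≤ ν + 1 := by linarith
    gcongr
  have hpos : 0 < C * Q * E := by positivity
  constructor
  · have e : besselSeries ν w =
        w / 2 * F₁ - w / 2 * (F₁ - w / 2 * F₂) + ((ν : ℂ) + 1) * F₁ := by rw [hrec]; ring
    have hF : ‖w / 2 * F₁‖ ≤ q * (C * Q * E) := by
      rw [norm_mul]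
      gcongr
    rw [e, e1]
    refine (norm_add_le _ _).trans ((add_le_add_left (norm_sub_le _ _) _).trans ?_)
    nlinarith [mul_nonneg (by linarith : 0 ≤ ν + 2) (mul_nonneg (sub_nonneg.2 hq1) hpos.le)]
  · have e : besselSeries ν w - w / 2 * F₁ =
        ((ν : ℂ) + 1) * F₁ - w / 2 * (F₁ - w / 2 * F₂) := by rw [hrec]; ring
    rw [e]
    refine (norm_sub_le _ _).trans ?_
    nlinarith

lemma besselSeriesBound {δ ν : ℝ} (hδ : 0 < δ) (hδ1 : δ ≤ 1) (hν : -1 < ν) :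
    BesselSeriesBound δ ν :=
  ((besselSeriesBound_of_half_lt hδ hδ1 (by linarith)).of_add_one (by linarith)).of_add_one hν

/-! ### Comparison of weights -/

/-- In the presence of a factor `exp (M |Y - R|)`, the weight `(1 + Y R / 2) ^ (-(s + t) / 2)` turns
the powers `R ^ s` and `Y ^ t` into those of the truncations `R ∧ 1` and `Y ∧ 1`. -/
lemma rpow_mul_rpow_mul_rpow_le {Y R : ℝ} (hY : 0 < Y) (hR : 0 < R) (s t : ℝ) :
    R ^ s * Y ^ t * (1 + Y * R / 2) ^ (-((s + t) / 2)) ≤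
      min R 1 ^ s * min Y 1 ^ t * Real.exp ((|s| + |t|) * (|Y - R| + 1)) := by
  set a := max Y 1
  set b := max R 1
  set q := 1 + Y * R / 2
  set u := |Y - R|
  have ha1 : 1 ≤ a := le_max_right _ _
  have hb1 : 1 ≤ b := le_max_right _ _
  have ha : 0 < a := by linarith
  have hb : 0 < b := by linarith
  have hq : 0 < q := by positivity
  have hYR : Y ≤ R + u := by linarith [le_abs_self (Y - R)]
  have hRY : R ≤ Y + u := by linarith [neg_abs_le (Y - R)]
  have hab : a ≤ (1 + u) * b := by
    refine max_le ?_ ?_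
    · nlinarith [le_max_left R 1]
    · nlinarith
  have hba : b ≤ (1 + u) * a := by
    refine max_le ?_ ?_
    · nlinarith [le_max_left Y 1]
    · nlinarith
  have hq_le : q ≤ 2 * (a * b) := by
    have h1 : Y * R ≤ a * b :=
      mul_le_mul (le_max_left _ _) (le_max_left _ _) hR.le ha.le
    have h2 : 1 ≤ a * b := one_le_mul_of_one_le_of_one_le ha1 hb1
    simp only [q]; linarith
  have hle_q : a * b ≤ 2 * q * (1 + u) := by
    have hpu : 0 ≤ Y * R * u := by positivity
    simp only [a, b, q]
    rcases le_total Y 1 with h1 | h1 <;> rcases le_total R 1 with h2 | h2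
    · rw [max_eq_right h1, max_eq_right h2]; nlinarith
    · rw [max_eq_right h1, max_eq_left h2]; nlinarith
    · rw [max_eq_left h1, max_eq_right h2]; nlinarith
    · rw [max_eq_left h1, max_eq_left h2]; nlinarith
  -- After taking logarithms, the claim is a linear combination of the four comparisons.
  have hlu : Real.log (1 + u) ≤ u := by
    have := Real.log_le_sub_one_of_pos (by linarith : 0 < 1 + u); linarith
  have hl2 : Real.log 2 ≤ 1 := by
    have := Real.log_le_sub_one_of_pos (by norm_num : (0 : ℝ) < 2); linarith
  have hu1 : (1 + u) ≠ 0 := by positivity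
  have l1 : Real.log a ≤ u + Real.log b := by
    have := Real.log_le_log ha hab
    rw [Real.log_mul hu1 hb.ne'] at this; linarith
  have l2 : Real.log b ≤ u + Real.log a := by
    have := Real.log_le_log hb hba
    rw [Real.log_mul hu1 ha.ne'] at this; linarith
  have l3 : Real.log q ≤ 1 + (Real.log a + Real.log b) := by
    have := Real.log_le_log hq hq_le
    rw [Real.log_mul two_ne_zero (by positivity), Real.log_mul ha.ne' hb.ne'] at this; linarith
  have l4 : Real.log a + Real.log b ≤ 1 + Real.log q + u := by
    have := Real.log_le_log (by positivity) hle_q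
    rw [Real.log_mul ha.ne' hb.ne', Real.log_mul (by positivity) hu1,
      Real.log_mul two_ne_zero hq.ne'] at this
    linarith
  have key : b ^ s * a ^ t * q ^ (-((s + t) / 2)) ≤ Real.exp ((|s| + |t|) * (u + 1)) := by
    rw [Real.rpow_def_of_pos hb, Real.rpow_def_of_pos ha, Real.rpow_def_of_pos hq, ← Real.exp_add,
      ← Real.exp_add]
    refine Real.exp_le_exp.2 ?_
    have e : Real.log b * s + Real.log a * t + Real.log q * -((s + t) / 2) =
        (s - t) / 2 * (Real.log b - Real.log a) +
          (s + t) / 2 * (Real.log a + Real.log b - Real.log q) := by ring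
    have h1 : (s - t) / 2 * (Real.log b - Real.log a) ≤ (|s| + |t|) / 2 * (u + 1) := by
      refine (le_abs_self _).trans ?_
      rw [abs_mul, abs_div, abs_two]
      gcongr
      · exact abs_sub s t
      · exact abs_le.2 ⟨by linarith, by linarith⟩
    have h2 : (s + t) / 2 * (Real.log a + Real.log b - Real.log q) ≤
        (|s| + |t|) / 2 * (u + 1) := by
      refine (le_abs_self _).trans ?_
      rw [abs_mul, abs_div, abs_two]
      gcongr
      · exact abs_add_le s t
      · exact abs_le.2 ⟨by linarith, by linarith⟩
    rw [e]
    linarith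
  have hmR : 0 < min R 1 := lt_min hR one_pos
  have hmY : 0 < min Y 1 := lt_min hY one_pos
  have eR : R ^ s = min R 1 ^ s * b ^ s := by
    rw [← Real.mul_rpow hmR.le hb.le, min_mul_max, mul_one]
  have eY : Y ^ t = min Y 1 ^ t * a ^ t := by
    rw [← Real.mul_rpow hmY.le ha.le, min_mul_max, mul_one]
  rw [eR, eY]
  have hm := mul_nonneg (Real.rpow_nonneg hmR.le s) (Real.rpow_nonneg hmY.le t)
  calc _ = min R 1 ^ s * min Y 1 ^ t * (b ^ s * a ^ t * q ^ (-((s + t) / 2))) := by ring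
    _ ≤ _ := by gcongr

lemma exp_mul_exp_neg_sq_le {k : ℝ} (hk : 0 < k) (M u : ℝ) :
    Real.exp (M * (u + 1)) * Real.exp (-(k * u ^ 2)) ≤
      Real.exp (M + M ^ 2 / (2 * k)) * Real.exp (-(k / 2 * u ^ 2)) := by
  rw [← Real.exp_add, ← Real.exp_add]
  refine Real.exp_le_exp.2 ?_
  have h : M + M ^ 2 / (2 * k) + -(k / 2 * u ^ 2) - (M * (u + 1) + -(k * u ^ 2)) =
      (M - k * u) ^ 2 / (2 * k) := by field_simp; ring
  have : 0 ≤ (M - k * u) ^ 2 / (2 * k) := by positivity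
  linarith

/-! ### The sector -/

lemma exists_mul_norm_le_re_of_mem_sector {ε : ℝ} (hε : 0 < ε) :
    ∃ δ : ℝ, 0 < δ ∧ δ ≤ 1 ∧ ∀ z ∈ sector (Real.pi / 2 - ε), z ≠ 0 ∧ δ * ‖z‖ ≤ z.re := by
  rcases le_or_gt ε (Real.pi / 2) with h | h
  · refine ⟨Real.cos (Real.pi / 2 - ε), Real.cos_pos_of_mem_Ioo ⟨by linarith, by linarith⟩,
      Real.cos_le_one _, fun z hz => ⟨hz.1, ?_⟩⟩
    rw [← Complex.norm_mul_cos_arg z, mul_comm, ← Real.cos_abs (Complex.arg z)]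
    have := Real.cos_le_cos_of_nonneg_of_le_pi (abs_nonneg (Complex.arg z))
      (by linarith [Real.pi_pos]) hz.2
    gcongr
  · refine ⟨1, one_pos, le_rfl, fun z hz => ?_⟩
    linarith [hz.2, abs_nonneg (Complex.arg z)]

lemma mul_norm_le_re_ofReal_mul_div {δ : ℝ} {z : ℂ} (hz : z ≠ 0) (hδz : δ * ‖z‖ ≤ z.re)
    {y ρ : ℝ} (hy : 0 < y) (hρ : 0 < ρ) :
    δ * ‖(y : ℂ) * (ρ : ℂ) / (2 * z)‖ ≤ ((y : ℂ) * (ρ : ℂ) / (2 * z)).re := by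
  have e : (y : ℂ) * (ρ : ℂ) / (2 * z) = ((y * ρ / 2 : ℝ) : ℂ) * z⁻¹ := by
    push_cast; field_simp
  rw [e, norm_mul, Complex.re_ofReal_mul, Complex.inv_re, norm_inv, Complex.norm_real,
    Real.norm_of_nonneg (by positivity), Complex.normSq_eq_norm_sq]
  calc δ * (y * ρ / 2 * ‖z‖⁻¹) = y * ρ / 2 * (δ * ‖z‖ / ‖z‖ ^ 2) := by field_simp
    _ ≤ _ := by gcongr

lemma norm_ofReal_mul_div {z : ℂ} (hz : z ≠ 0) {y ρ : ℝ} (hy : 0 < y) (hρ : 0 < ρ) :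
    ‖(y : ℂ) * (ρ : ℂ) / (2 * z)‖ = y / √‖z‖ * (ρ / √‖z‖) / 2 := by
  have hr : 0 < ‖z‖ := norm_pos_iff.2 hz
  rw [norm_div, norm_mul, norm_mul, Complex.norm_two, Complex.norm_real, Complex.norm_real,
    Real.norm_of_nonneg hy.le, Real.norm_of_nonneg hρ.le]
  conv_lhs => rw [← Real.mul_self_sqrt hr.le]
  field_simp

/-- The exponential growth of `I_ν(yρ/(2z))` completes the square in the Gaussian factor. -/
lemma norm_exp_mul_exp_re_le {δ : ℝ} {z : ℂ} (hz : z ≠ 0) (hδz : δ * ‖z‖ ≤ z.re) (y ρ : ℝ) :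
    ‖Complex.exp (-((y : ℂ) ^ 2 + (ρ : ℂ) ^ 2) / (4 * z))‖ *
        Real.exp ((y : ℂ) * (ρ : ℂ) / (2 * z)).re ≤
      Real.exp (-(δ / 4 * |y / √‖z‖ - ρ / √‖z‖| ^ 2)) := by
  have hr : 0 < ‖z‖ := norm_pos_iff.2 hz
  rw [Complex.norm_exp, ← Real.exp_add, ← Complex.add_re]
  refine Real.exp_le_exp.2 ?_
  have e : -((y : ℂ) ^ 2 + (ρ : ℂ) ^ 2) / (4 * z) + (y : ℂ) * (ρ : ℂ) / (2 * z) =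
      ((-((y - ρ) ^ 2 / 4) : ℝ) : ℂ) * z⁻¹ := by
    push_cast; field_simp; ring
  rw [e, Complex.re_ofReal_mul, Complex.inv_re, Complex.normSq_eq_norm_sq, ← sub_div, sq_abs,
    div_pow, Real.sq_sqrt hr.le, neg_mul, neg_le_neg_iff]
  calc δ / 4 * ((y - ρ) ^ 2 / ‖z‖) = (y - ρ) ^ 2 / 4 * (δ * ‖z‖ / ‖z‖ ^ 2) := by field_simp
    _ ≤ _ := by gcongr

/-! ### The heat kernels -/

/-- With the power `(w/2)^ν` split off from `I_ν(w)`, the kernel is elementary up to the entire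
factor `besselSeries`. -/
lemma besselHeatKernel_eq (ν c : ℝ) {z : ℂ} (hz : z ≠ 0) {y ρ : ℝ} (hy : 0 < y) (hρ : 0 < ρ) :
    besselHeatKernel ν c z y ρ =
      1 / (2 * z) * (1 / (4 * z)) ^ (ν : ℂ) * ((ρ ^ ((1 + c) / 2 + ν) : ℝ) : ℂ) *
        (((y ^ ((1 - c) / 2 + ν) : ℝ) : ℂ) *
          (Complex.exp (-((y : ℂ) ^ 2 + (ρ : ℂ) ^ 2) / (4 * z)) *
            besselSeries ν ((y : ℂ) * (ρ : ℂ) / (2 * z)))) := by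
  have hyρ : 0 < y * ρ := mul_pos hy hρ
  have hi : 1 / (4 * z) ≠ 0 := by simpa using hz
  have hw : (y : ℂ) * (ρ : ℂ) / (2 * z) / 2 = ((y * ρ : ℝ) : ℂ) * (1 / (4 * z)) := by
    push_cast; field_simp; norm_num
  have hpow : (((y * ρ : ℝ) : ℂ) * (1 / (4 * z))) ^ (ν : ℂ) =
      (((y * ρ) ^ ν : ℝ) : ℂ) * (1 / (4 * z)) ^ (ν : ℂ) := by
    have hne : ((y * ρ : ℝ) : ℂ) ≠ 0 := by exact_mod_cast hyρ.ne'
    rw [Complex.cpow_def_of_ne_zero (mul_ne_zero hne hi), Complex.log_ofReal_mul hyρ hi,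
      Complex.ofReal_cpow hyρ.le, Complex.cpow_def_of_ne_zero hne, Complex.cpow_def_of_ne_zero hi,
      ← Complex.exp_add, Complex.ofReal_log hyρ.le, add_mul]
  have hreal : ρ ^ c * ((y * ρ) ^ ((1 - c) / 2) * (y * ρ) ^ ν) =
      ρ ^ ((1 + c) / 2 + ν) * y ^ ((1 - c) / 2 + ν) := by
    rw [← Real.rpow_add hyρ, Real.mul_rpow hy.le hρ.le, mul_left_comm, ← Real.rpow_add hρ, mul_comm]
    congr 2
    ring
  have hreal' := congrArg (fun x : ℝ => (x : ℂ)) hreal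
  simp only [Complex.ofReal_mul] at hreal'
  rw [besselHeatKernel, show ∀ w, besselI ν w = (w / 2) ^ (ν : ℂ) * besselSeries ν w from
    fun _ => rfl, hw, hpow]
  linear_combination 1 / (2 * z) * (1 / (4 * z)) ^ (ν : ℂ) *
    Complex.exp (-((y : ℂ) ^ 2 + (ρ : ℂ) ^ 2) / (4 * z)) *
    besselSeries ν ((y : ℂ) * (ρ : ℂ) / (2 * z)) * hreal'

lemma norm_prefactor (ν : ℝ) {z : ℂ} (hz : z ≠ 0) :
    ‖1 / (2 * z) * (1 / (4 * z)) ^ (ν : ℂ)‖ = 1 / 2 * (1 / 4) ^ ν * ‖z‖ ^ (-(1 + ν)) := by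
  have hr : 0 < ‖z‖ := norm_pos_iff.2 hz
  rw [norm_mul, Complex.norm_cpow_real, norm_div, norm_div, norm_mul, norm_mul, norm_one,
    Complex.norm_two, Complex.norm_ofNat, one_div_mul_eq_div, ← one_div_mul_one_div,
    Real.mul_rpow (by positivity) (by positivity), one_div ‖z‖, Real.inv_rpow hr.le,
    Real.rpow_neg hr.le, Real.rpow_add hr, Real.rpow_one]
  field_simp

/-- The powers of `ρ` and `y` in the kernel, in the parabolically scaled variables. -/
lemma rpow_mul_rpow_eq_scaled {r y ρ : ℝ} (hr : 0 < r) (hy : 0 < y) (hρ : 0 < ρ) (s t : ℝ) :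
    ρ ^ s * y ^ t = r ^ ((s + t) / 2) * ((ρ / √r) ^ s * (y / √r) ^ t) := by
  have hs : 0 < √r := Real.sqrt_pos.2 hr
  rw [Real.div_rpow hρ.le hs.le, Real.div_rpow hy.le hs.le, Real.sqrt_eq_rpow, ← Real.rpow_mul hr.le,
    ← Real.rpow_mul hr.le, show (s + t) / 2 = 1 / 2 * s + 1 / 2 * t by ring, Real.rpow_add hr]
  field_simp

lemma hasDerivAt_besselHeatKernel {ν : ℝ} (hν : -1 < ν) (c : ℝ) {z : ℂ} (hz : z ≠ 0) {y ρ : ℝ}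
    (hy : 0 < y) (hρ : 0 < ρ) :
    HasDerivAt (fun t : ℝ => besselHeatKernel ν c z t ρ)
      (1 / (2 * z) * (1 / (4 * z)) ^ (ν : ℂ) * ((ρ ^ ((1 + c) / 2 + ν) : ℝ) : ℂ) *
        (((y ^ ((1 - c) / 2 + ν) : ℝ) : ℂ) *
          ((((((1 - c) / 2 + ν) / y : ℝ) : ℂ) *
            (Complex.exp (-((y : ℂ) ^ 2 + (ρ : ℂ) ^ 2) / (4 * z)) *
              besselSeries ν ((y : ℂ) * (ρ : ℂ) / (2 * z)))) +
          Complex.exp (-((y : ℂ) ^ 2 + (ρ : ℂ) ^ 2) / (4 * z)) *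
            ((-(y : ℂ) * besselSeries ν ((y : ℂ) * (ρ : ℂ) / (2 * z)) +
              (ρ : ℂ) * ((y : ℂ) * (ρ : ℂ) / (2 * z) / 2 *
                besselSeries (ν + 1) ((y : ℂ) * (ρ : ℂ) / (2 * z)))) / (2 * z))))) y := by
  set τ := (1 - c) / 2 + ν
  have h1 : HasDerivAt (fun t : ℝ => ((t ^ τ : ℝ) : ℂ))
      (((y ^ τ : ℝ) : ℂ) * ((τ / y : ℝ) : ℂ)) y := by
    refine (Real.hasDerivAt_rpow_const (p := τ) (Or.inl hy.ne')).ofReal_comp.congr_deriv ?_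
    rw [Real.rpow_sub_one hy.ne', ← Complex.ofReal_mul]
    congr 1
    ring
  have h2 : HasDerivAt (fun t : ℂ => Complex.exp (-(t ^ 2 + (ρ : ℂ) ^ 2) / (4 * z)))
      (Complex.exp (-((y : ℂ) ^ 2 + (ρ : ℂ) ^ 2) / (4 * z)) * (-(2 * (y : ℂ)) / (4 * z))) (y : ℂ) := by
    have h := (((hasDerivAt_id (y : ℂ)).pow 2).add_const ((ρ : ℂ) ^ 2)).neg.div_const (4 * z)
    simpa using h.cexp
  have h3 : HasDerivAt (fun t : ℂ => besselSeries ν (t * (ρ : ℂ) / (2 * z)))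
      ((y : ℂ) * (ρ : ℂ) / (2 * z) / 2 * besselSeries (ν + 1) ((y : ℂ) * (ρ : ℂ) / (2 * z)) *
        ((ρ : ℂ) / (2 * z))) (y : ℂ) := by
    have h := ((hasDerivAt_id (y : ℂ)).mul_const (ρ : ℂ)).div_const (2 * z)
    simp only [id, one_mul] at h
    exact (hasDerivAt_besselSeries hν _).comp (y : ℂ) h
  have h := (h1.mul (h2.mul h3).comp_ofReal).const_mul
    (1 / (2 * z) * (1 / (4 * z)) ^ (ν : ℂ) * ((ρ ^ ((1 + c) / 2 + ν) : ℝ) : ℂ))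
  refine (h.congr_of_eventuallyEq ?_).congr_deriv ?_
  · filter_upwards [lt_mem_nhds hy] with t ht
    exact besselHeatKernel_eq ν c hz ht hρ
  · simp only [Pi.mul_apply]
    field_simp
    ring

/-- The scaled derivative `-Y F + R F'`, with `F' = (w/2) F₁`: for `Y ≥ 1` it is
`(R - Y) F - R (F - F')`, where the gain in `F - F'` compensates `R`; for `Y ≤ 1` both terms carry a
factor `Y`. -/
lemma norm_neg_mul_add_mul_le {Y R C₀ C₁ B : ℝ} {w F F₁ : ℂ} (hY : 0 < Y) (hR : 0 < R)
    (hC₀ : 0 < C₀) (hC₁ : 0 < C₁) (hB : 0 < B) (hw : ‖w‖ = Y * R / 2) (hF : ‖F‖ ≤ C₀ * B)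
    (hD : ‖F - w / 2 * F₁‖ ≤ C₀ * (B / (1 + Y * R / 2))) (hF₁ : ‖F₁‖ ≤ C₁ * B) :
    ‖-(Y : ℂ) * F + (R : ℂ) * (w / 2 * F₁)‖ ≤
      8 * (C₀ + C₁) * min Y 1 * (|Y - R| + 1) ^ 2 * B := by
  set u := |Y - R|
  have hu : 0 ≤ u := abs_nonneg _
  have nR : ‖(R : ℂ)‖ = R := by rw [Complex.norm_real, Real.norm_of_nonneg hR.le]
  rcases le_total Y 1 with hY1 | hY1
  · rw [min_eq_left hY1]
    have hRu : R ≤ 1 + u := by linarith [neg_abs_le (Y - R)]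
    have nY : ‖-(Y : ℂ)‖ = Y := by
      rw [norm_neg, Complex.norm_real, Real.norm_of_nonneg hY.le]
    have nw : ‖w / 2‖ = Y * R / 4 := by rw [norm_div, Complex.norm_two, hw]; ring
    have h1 : 1 ≤ 8 * (u + 1) ^ 2 := by nlinarith
    have h2 : R ^ 2 / 4 ≤ 8 * (u + 1) ^ 2 := by nlinarith
    refine (norm_add_le _ _).trans ?_
    rw [norm_mul, norm_mul, norm_mul (w / 2), nR, nY, nw]
    calc Y * ‖F‖ + R * (Y * R / 4 * ‖F₁‖)
        ≤ Y * (C₀ * B) + R * (Y * R / 4 * (C₁ * B)) := by gcongr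
      _ = Y * B * (C₀ * 1 + C₁ * (R ^ 2 / 4)) := by ring
      _ ≤ Y * B * (C₀ * (8 * (u + 1) ^ 2) + C₁ * (8 * (u + 1) ^ 2)) := by gcongr
      _ = _ := by ring
  · rw [min_eq_right hY1]
    have hq : 0 < 1 + Y * R / 2 := by positivity
    have hRq : R / (1 + Y * R / 2) ≤ 2 := by
      rw [div_le_iff₀ hq]; nlinarith
    have e : -(Y : ℂ) * F + (R : ℂ) * (w / 2 * F₁) =
        ((R - Y : ℝ) : ℂ) * F - (R : ℂ) * (F - w / 2 * F₁) := by
      push_cast; ring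
    have nu : ‖((R - Y : ℝ) : ℂ)‖ = u := by
      rw [Complex.norm_real, Real.norm_eq_abs, abs_sub_comm]
    have h1 : u + R / (1 + Y * R / 2) ≤ 8 * (u + 1) ^ 2 := by nlinarith
    rw [e]
    refine (norm_sub_le _ _).trans ?_
    rw [norm_mul, norm_mul, nR, nu]
    calc u * ‖F‖ + R * ‖F - w / 2 * F₁‖
        ≤ u * (C₀ * B) + R * (C₀ * (B / (1 + Y * R / 2))) := by gcongr
      _ = (C₀ + 0) * B * (u + R / (1 + Y * R / 2)) := by ring
      _ ≤ (C₀ + C₁) * B * (8 * (u + 1) ^ 2) := by gcongr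
      _ = _ := by ring

/-- The product of the Gaussian and the Bessel series, and its `y`-derivative. The derivative is
`(-y F + ρ F') / (2 z)` times the Gaussian; it gains the factor `y/√|z| ∧ 1`, at the cost of an
exponential of `|y - ρ|/√|z|`. -/
lemma exists_norm_exp_mul_besselSeries_le {δ ν : ℝ} (hδ : 0 < δ) (hδ1 : δ ≤ 1) (hν : -1 < ν) :
    ∃ C > 0, ∀ z : ℂ, z ≠ 0 → δ * ‖z‖ ≤ z.re → ∀ y ρ : ℝ, 0 < y → 0 < ρ →
      ‖Complex.exp (-((y : ℂ) ^ 2 + (ρ : ℂ) ^ 2) / (4 * z)) *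
          besselSeries ν ((y : ℂ) * (ρ : ℂ) / (2 * z))‖ ≤
        C * (1 + y / √‖z‖ * (ρ / √‖z‖) / 2) ^ (-(ν + 1 / 2)) *
          Real.exp (-(δ / 4 * |y / √‖z‖ - ρ / √‖z‖| ^ 2)) ∧
      ‖Complex.exp (-((y : ℂ) ^ 2 + (ρ : ℂ) ^ 2) / (4 * z)) *
          ((-(y : ℂ) * besselSeries ν ((y : ℂ) * (ρ : ℂ) / (2 * z)) +
            (ρ : ℂ) * ((y : ℂ) * (ρ : ℂ) / (2 * z) / 2 *
              besselSeries (ν + 1) ((y : ℂ) * (ρ : ℂ) / (2 * z)))) / (2 * z))‖ ≤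
        C * (√‖z‖)⁻¹ * (min (y / √‖z‖) 1 *
          Real.exp (2 * (|y / √‖z‖ - ρ / √‖z‖| + 1))) *
          ((1 + y / √‖z‖ * (ρ / √‖z‖) / 2) ^ (-(ν + 1 / 2)) *
            Real.exp (-(δ / 4 * |y / √‖z‖ - ρ / √‖z‖| ^ 2))) := by
  obtain ⟨C₀, hC₀, h₀⟩ := besselSeriesBound hδ hδ1 hν
  obtain ⟨C₁, hC₁, h₁⟩ := besselSeriesBound hδ hδ1 (ν := ν + 1) (by linarith)
  refine ⟨C₀ + C₁, by positivity, fun z hz hδz y ρ hy hρ => ?_⟩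
  have hr : 0 < ‖z‖ := norm_pos_iff.2 hz
  have hs : 0 < √‖z‖ := Real.sqrt_pos.2 hr
  have hw := mul_norm_le_re_ofReal_mul_div hz hδz hy hρ
  have hwn := norm_ofReal_mul_div hz hy hρ
  have hG := norm_exp_mul_exp_re_le hz hδz y ρ
  obtain ⟨hF, hD⟩ := h₀ _ hw
  obtain ⟨hF₁, -⟩ := h₁ _ hw
  rw [hwn] at hF hD hF₁
  set w := (y : ℂ) * (ρ : ℂ) / (2 * z)
  set H := Complex.exp (-((y : ℂ) ^ 2 + (ρ : ℂ) ^ 2) / (4 * z))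
  set Y := y / √‖z‖ with hYdef
  set R := ρ / √‖z‖ with hRdef
  have hY : 0 < Y := by positivity
  have hR : 0 < R := by positivity
  set q := 1 + Y * R / 2
  have hq1 : 1 ≤ q := by simp only [q]; linarith [mul_pos hY hR]
  have hq : 0 < q := by linarith
  set u := |Y - R|
  set Γ := Real.exp (-(δ / 4 * u ^ 2))
  set Q := q ^ (-(ν + 1 / 2))
  have hQ : 0 < Q := Real.rpow_pos_of_pos hq _
  have hQ' : q ^ (-(ν + 3 / 2)) = Q / q := by
    rw [show -(ν + 3 / 2) = -(ν + 1 / 2) - 1 by ring, Real.rpow_sub_one hq.ne']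
  set E := Real.exp w.re
  rw [hQ'] at hD
  rw [show ν + 1 + 1 / 2 = ν + 3 / 2 by ring, hQ'] at hF₁
  have hQq : Q / q ≤ Q := div_le_self hQ.le hq1
  have ey : y = √‖z‖ * Y := by rw [hYdef]; field_simp
  have eρ : ρ = √‖z‖ * R := by rw [hRdef]; field_simp
  have hsq : √‖z‖ * √‖z‖ = ‖z‖ := Real.mul_self_sqrt hr.le
  -- It suffices to estimate in units of `E = exp (Re w)`, which the Gaussian factor absorbs.
  have absorb : ∀ {A : ℝ} {B : ℂ}, 0 ≤ A → ‖B‖ ≤ A * E → ‖H * B‖ ≤ A * Γ := by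
    intro A B hA hB
    rw [norm_mul]
    calc ‖H‖ * ‖B‖ ≤ ‖H‖ * (A * E) := by gcongr
      _ = A * (‖H‖ * E) := by ring
      _ ≤ A * Γ := by gcongr
  have hexp : u + 1 ≤ Real.exp u := Real.add_one_le_exp u
  have hexp2 : Real.exp (2 * (u + 1)) = Real.exp u ^ 2 * Real.exp 1 ^ 2 := by
    rw [← Real.exp_nat_mul, ← Real.exp_nat_mul, ← Real.exp_add]; congr 1; push_cast; ring
  have he1 : 2 ≤ Real.exp 1 := by linarith [Real.add_one_le_exp (1 : ℝ)]
  have hsqu : (u + 1) ^ 2 ≤ Real.exp u ^ 2 := by gcongr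
  have hbig : 4 * (u + 1) ^ 2 ≤ Real.exp (2 * (u + 1)) := by
    have h4 : 4 ≤ Real.exp 1 ^ 2 := by nlinarith
    rw [hexp2, mul_comm 4]
    gcongr
  have hnorm : ∀ B : ℂ, ‖B / (2 * z)‖ = ‖B‖ / (2 * (√‖z‖ * √‖z‖)) := by
    intro B; rw [norm_div, norm_mul, Complex.norm_two, hsq]
  constructor
  · refine absorb (by positivity) (hF.trans ?_)
    gcongr
    linarith
  · rw [← mul_assoc _ Q Γ]
    refine absorb (by positivity) ?_
    rw [hnorm, div_le_iff₀ (by positivity)]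
    have e : -(y : ℂ) * besselSeries ν w + (ρ : ℂ) * (w / 2 * besselSeries (ν + 1) w) =
        ((√‖z‖ : ℝ) : ℂ) *
          (-(Y : ℂ) * besselSeries ν w + (R : ℂ) * (w / 2 * besselSeries (ν + 1) w)) := by
      rw [ey, eρ]; push_cast; ring
    have hB := norm_neg_mul_add_mul_le hY hR hC₀ hC₁ (B := Q * E) (by positivity) hwn
      (by rwa [← mul_assoc])
      (hD.trans_eq (by ring)) (hF₁.trans (by rw [mul_assoc]; gcongr))
    rw [e, norm_mul, Complex.norm_real, Real.norm_of_nonneg hs.le]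
    calc _ ≤ √‖z‖ * (2 * (C₀ + C₁) * (min Y 1 * (4 * (u + 1) ^ 2)) * (Q * E)) := by
          gcongr
          exact hB.trans_eq (by ring)
      _ ≤ √‖z‖ * (2 * (C₀ + C₁) * (min Y 1 * Real.exp (2 * (u + 1))) * (Q * E)) := by gcongr
      _ = _ := by field_simp

/-- The kernel estimates for an arbitrary index: the Dirichlet and Neumann kernels are the two
choices `ν = ±(1 - c)/2`. -/
lemma exists_besselHeatKernel_bounds {δ ν : ℝ} (hδ : 0 < δ) (hδ1 : δ ≤ 1) (hν : -1 < ν) (c : ℝ) :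
    ∃ C > 0, ∀ z : ℂ, z ≠ 0 → δ * ‖z‖ ≤ z.re → ∀ y ρ : ℝ, 0 < y → 0 < ρ →
      ‖besselHeatKernel ν c z y ρ‖ ≤
        C * ‖z‖ ^ (-(1 / 2) : ℝ) * (min (ρ / √‖z‖) 1 ^ ((1 + c) / 2 + ν) *
          min (y / √‖z‖) 1 ^ ((1 - c) / 2 + ν)) *
            Real.exp (-(δ / 8 * |y / √‖z‖ - ρ / √‖z‖| ^ 2)) ∧
      DifferentiableAt ℝ (fun t : ℝ => besselHeatKernel ν c z t ρ) y ∧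
      ‖deriv (fun t : ℝ => besselHeatKernel ν c z t ρ) y‖ ≤
        C * ‖z‖⁻¹ * (min (ρ / √‖z‖) 1 ^ ((1 + c) / 2 + ν) *
          min (y / √‖z‖) 1 ^ ((1 - c) / 2 + ν)) *
          (|(1 - c) / 2 + ν| / min (y / √‖z‖) 1 + min (y / √‖z‖) 1) *
            Real.exp (-(δ / 8 * |y / √‖z‖ - ρ / √‖z‖| ^ 2)) := by
  obtain ⟨C, hC, h⟩ := exists_norm_exp_mul_besselSeries_le hδ hδ1 hν
  set s := (1 + c) / 2 + ν with hs_def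
  set τ := (1 - c) / 2 + ν with hτ_def
  set M := |s| + |τ| + 2
  refine ⟨1 / 2 * (1 / 4) ^ ν * C * Real.exp (M + M ^ 2 / (2 * (δ / 4))), by positivity,
    fun z hz hδz y ρ hy hρ => ?_⟩
  obtain ⟨hK, hV⟩ := h z hz hδz y ρ hy hρ
  have hr : 0 < ‖z‖ := norm_pos_iff.2 hz
  have hd := hasDerivAt_besselHeatKernel hν c hz hy hρ
  rw [besselHeatKernel_eq ν c hz hy hρ, hd.deriv]
  have hpow := rpow_mul_rpow_eq_scaled hr hy hρ s τ
  have hY : 0 < y / √‖z‖ := by positivity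
  have hR : 0 < ρ / √‖z‖ := by positivity
  have hW := rpow_mul_rpow_mul_rpow_le hY hR s τ
  have hσ : (s + τ) / 2 = ν + 1 / 2 := by rw [hs_def, hτ_def]; ring
  rw [hσ] at hW hpow
  have hgauss := exp_mul_exp_neg_sq_le (k := δ / 4) (by positivity) M |y / √‖z‖ - ρ / √‖z‖|
  rw [show δ / 4 / 2 = δ / 8 by ring] at hgauss
  have hr1 : ‖z‖ ^ (-(1 + ν)) * ‖z‖ ^ (ν + 1 / 2) = ‖z‖ ^ (-(1 / 2) : ℝ) := by
    rw [← Real.rpow_add hr]; congr 1; ring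
  have hr2 : ‖z‖ ^ (-(1 / 2) : ℝ) = (√‖z‖)⁻¹ := by
    rw [Real.rpow_neg hr.le, Real.sqrt_eq_rpow]
  have hr3 : (√‖z‖)⁻¹ * (√‖z‖)⁻¹ = ‖z‖⁻¹ := by
    rw [← mul_inv, Real.mul_self_sqrt hr.le]
  have hnorm : ∀ X : ℂ, ‖1 / (2 * z) * (1 / (4 * z)) ^ (ν : ℂ) * ((ρ ^ s : ℝ) : ℂ) *
      (((y ^ τ : ℝ) : ℂ) * X)‖ = 1 / 2 * (1 / 4) ^ ν * (√‖z‖)⁻¹ *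
        ((ρ / √‖z‖) ^ s * (y / √‖z‖) ^ τ) * ‖X‖ := by
    intro X
    rw [norm_mul _ (((y ^ τ : ℝ) : ℂ) * X), norm_mul _ ((ρ ^ s : ℝ) : ℂ),
      norm_mul _ X, norm_prefactor ν hz, Complex.norm_real, Complex.norm_real,
      Real.norm_of_nonneg (Real.rpow_nonneg hρ.le s), Real.norm_of_nonneg (Real.rpow_nonneg hy.le τ)]
    calc _ = 1 / 2 * (1 / 4) ^ ν * ‖z‖ ^ (-(1 + ν)) * (ρ ^ s * y ^ τ) * ‖X‖ := by ring
      _ = 1 / 2 * (1 / 4) ^ ν * (‖z‖ ^ (-(1 + ν)) * ‖z‖ ^ (ν + 1 / 2)) *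
          ((ρ / √‖z‖) ^ s * (y / √‖z‖) ^ τ) * ‖X‖ := by rw [hpow]; ring
      _ = _ := by rw [hr1, hr2]
  rw [hnorm, hnorm, hr2]
  set H := Complex.exp (-((y : ℂ) ^ 2 + (ρ : ℂ) ^ 2) / (4 * z))
  set F := besselSeries ν ((y : ℂ) * (ρ : ℂ) / (2 * z))
  set V := H * ((-(y : ℂ) * F + (ρ : ℂ) * ((y : ℂ) * (ρ : ℂ) / (2 * z) / 2 *
              besselSeries (ν + 1) ((y : ℂ) * (ρ : ℂ) / (2 * z)))) / (2 * z))
  set Y := y / √‖z‖ with hY_def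
  set R := ρ / √‖z‖
  set u := |Y - R|
  set Q := (1 + Y * R / 2) ^ (-(ν + 1 / 2))
  have hQ : 0 < Q := Real.rpow_pos_of_pos (by positivity) _
  set G := Real.exp (-(δ / 4 * u ^ 2))
  set G' := Real.exp (-(δ / 8 * u ^ 2))
  set m := min Y 1
  have hm : 0 < m := lt_min hY one_pos
  set W := min R 1 ^ s * m ^ τ
  set A := Real.exp (M + M ^ 2 / (2 * (δ / 4)))
  set κ : ℝ := 1 / 2 * (1 / 4) ^ ν
  set e₂ := Real.exp (2 * (u + 1))
  have he₂ : 1 ≤ e₂ := Real.one_le_exp (by positivity)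
  -- All powers are absorbed at once, with the factor `e₂` to spare.
  have main : R ^ s * Y ^ τ * (Q * e₂ * G) ≤ W * (A * G') := by
    calc R ^ s * Y ^ τ * (Q * e₂ * G) = R ^ s * Y ^ τ * Q * (e₂ * G) := by ring
      _ ≤ W * Real.exp ((|s| + |τ|) * (u + 1)) * (e₂ * G) := by gcongr
      _ = W * (Real.exp (M * (u + 1)) * G) := by
          rw [show M * (u + 1) = (|s| + |τ|) * (u + 1) + 2 * (u + 1) by simp only [M]; ring,
            Real.exp_add]
          ring
      _ ≤ W * (A * G') := by gcongr
  have hK' : ‖H * F‖ ≤ C * (Q * e₂ * G) := by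
    refine hK.trans ?_
    calc C * Q * G = C * (Q * 1 * G) := by ring
      _ ≤ _ := by gcongr
  refine ⟨?_, hd.differentiableAt, ?_⟩
  · calc κ * (√‖z‖)⁻¹ * (R ^ s * Y ^ τ) * ‖H * F‖
        ≤ κ * (√‖z‖)⁻¹ * (R ^ s * Y ^ τ) * (C * (Q * e₂ * G)) := by gcongr
      _ = κ * (√‖z‖)⁻¹ * C * (R ^ s * Y ^ τ * (Q * e₂ * G)) := by ring
      _ ≤ κ * (√‖z‖)⁻¹ * C * (W * (A * G')) := by gcongr
      _ = _ := by ring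
  · have hτy : ‖((τ / y : ℝ) : ℂ)‖ ≤ (√‖z‖)⁻¹ * (|τ| / m) := by
      rw [Complex.norm_real, Real.norm_eq_abs, abs_div, abs_of_pos hy]
      calc |τ| / y = (√‖z‖)⁻¹ * (|τ| / Y) := by rw [hY_def]; field_simp
        _ ≤ _ := by gcongr; exact min_le_left _ _
    have hsum : ‖((τ / y : ℝ) : ℂ) * (H * F) + V‖ ≤
        (√‖z‖)⁻¹ * (|τ| / m + m) * (C * (Q * e₂ * G)) := by
      refine (norm_add_le _ _).trans ?_
      rw [norm_mul]
      calc _ ≤ (√‖z‖)⁻¹ * (|τ| / m) * (C * (Q * e₂ * G)) + C * (√‖z‖)⁻¹ * (m * e₂) * (Q * G) := by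
            gcongr
        _ = _ := by ring
    calc κ * (√‖z‖)⁻¹ * (R ^ s * Y ^ τ) * ‖((τ / y : ℝ) : ℂ) * (H * F) + V‖
        ≤ κ * (√‖z‖)⁻¹ * (R ^ s * Y ^ τ) *
            ((√‖z‖)⁻¹ * (|τ| / m + m) * (C * (Q * e₂ * G))) := by gcongr
      _ = κ * C * ((√‖z‖)⁻¹ * (√‖z‖)⁻¹) * (|τ| / m + m) * (R ^ s * Y ^ τ * (Q * e₂ * G)) := by ring
      _ ≤ κ * C * ((√‖z‖)⁻¹ * (√‖z‖)⁻¹) * (|τ| / m + m) * (W * (A * G')) := by gcongr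
      _ = _ := by rw [hr3]; ring

theorem mainTheorem10 (c ε : ℝ) (hε : 0 < ε) :
    (∃ C > (0 : ℝ), ∃ κ > (0 : ℝ), ∀ z ∈ sector (Real.pi / 2 - ε), ∀ y ρ : ℝ, 0 < y → 0 < ρ →
      (c < 1 →
        ‖heatKernelDirichlet c z y ρ‖ ≤
          C * ‖z‖ ^ (-(1 / 2) : ℝ) * (min (y / √‖z‖) 1) ^ (1 - c) * min (ρ / √‖z‖) 1 *
            Real.exp (-(|y - ρ| ^ 2 / (κ * ‖z‖)))) ∧
      (-1 < c →
        ‖heatKernelNeumann c z y ρ‖ ≤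
          C * ‖z‖ ^ (-(1 / 2) : ℝ) * (min (ρ / √‖z‖) 1) ^ c *
            Real.exp (-(|y - ρ| ^ 2 / (κ * ‖z‖))))) ∧
    (∃ C > (0 : ℝ), ∃ κ > (0 : ℝ), ∀ z ∈ sector (Real.pi / 2 - ε), ∀ y ρ : ℝ, 0 < y → 0 < ρ →
      (c < 1 →
        DifferentiableAt ℝ (fun t : ℝ => heatKernelDirichlet c z t ρ) y ∧
        ‖deriv (fun t : ℝ => heatKernelDirichlet c z t ρ) y‖ ≤
          C * ‖z‖⁻¹ * (min (y / √‖z‖) 1) ^ (-c) * min (ρ / √‖z‖) 1 *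
            Real.exp (-(|y - ρ| ^ 2 / (κ * ‖z‖)))) ∧
      (-1 < c →
        DifferentiableAt ℝ (fun t : ℝ => heatKernelNeumann c z t ρ) y ∧
        ‖deriv (fun t : ℝ => heatKernelNeumann c z t ρ) y‖ ≤
          C * ‖z‖⁻¹ * min (y / √‖z‖) 1 * (min (ρ / √‖z‖) 1) ^ c *
            Real.exp (-(|y - ρ| ^ 2 / (κ * ‖z‖))))) := by
  obtain ⟨δ, hδ, hδ1, hsec⟩ := exists_mul_norm_le_re_of_mem_sector hε
  -- The rate `δ / 8` in the scaled variables is `κ = 8 / δ` in the original ones.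
  have hκ : ∀ (z : ℂ), z ≠ 0 → ∀ y ρ : ℝ,
      Real.exp (-(δ / 8 * |y / √‖z‖ - ρ / √‖z‖| ^ 2)) =
        Real.exp (-(|y - ρ| ^ 2 / (8 / δ * ‖z‖))) := by
    intro z hz y ρ
    have hr : 0 < ‖z‖ := norm_pos_iff.2 hz
    rw [← sub_div, sq_abs, sq_abs, div_pow, Real.sq_sqrt hr.le]
    congr 2
    field_simp
  -- For `ν = (1 - c) / 2` the exponents of `ρ` and `y` are `1` and `1 - c`, and the term with `1 / y`
  -- dominates the derivative.
  have hd : ∃ C > 0, ∀ z ∈ sector (Real.pi / 2 - ε), ∀ y ρ : ℝ, 0 < y → 0 < ρ → c < 1 →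
      ‖heatKernelDirichlet c z y ρ‖ ≤
        C * ‖z‖ ^ (-(1 / 2) : ℝ) * (min (y / √‖z‖) 1) ^ (1 - c) * min (ρ / √‖z‖) 1 *
          Real.exp (-(|y - ρ| ^ 2 / (8 / δ * ‖z‖))) ∧
      DifferentiableAt ℝ (fun t : ℝ => heatKernelDirichlet c z t ρ) y ∧
      ‖deriv (fun t : ℝ => heatKernelDirichlet c z t ρ) y‖ ≤
        C * ‖z‖⁻¹ * (min (y / √‖z‖) 1) ^ (-c) * min (ρ / √‖z‖) 1 *
          Real.exp (-(|y - ρ| ^ 2 / (8 / δ * ‖z‖))) := by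
    by_cases hc : c < 1
    · obtain ⟨C, hC, h⟩ := exists_besselHeatKernel_bounds hδ hδ1 (ν := (1 - c) / 2)
        (by linarith) c
      refine ⟨C * (1 - c + 1), mul_pos hC (by linarith), fun z hz y ρ hy hρ _ => ?_⟩
      obtain ⟨hz0, hzδ⟩ := hsec z hz
      obtain ⟨h1, h2, h3⟩ := h z hz0 hzδ y ρ hy hρ
      have hr : 0 < ‖z‖ := norm_pos_iff.2 hz0
      rw [show (1 + c) / 2 + (1 - c) / 2 = 1 by ring, show (1 - c) / 2 + (1 - c) / 2 = 1 - c by ring,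
        Real.rpow_one, hκ z hz0] at h1 h3
      rw [abs_of_pos (by linarith)] at h3
      have hm : 0 < min (y / √‖z‖) 1 := lt_min (by positivity) one_pos
      have hm1 : min (y / √‖z‖) 1 ≤ 1 := min_le_right _ _
      have hp : min (y / √‖z‖) 1 ^ (1 - c) = min (y / √‖z‖) 1 * min (y / √‖z‖) 1 ^ (-c) := by
        rw [show 1 - c = -c + 1 by ring, Real.rpow_add_one hm.ne', mul_comm]
      set m := min (y / √‖z‖) 1
      have hmp : ∀ t : ℝ, 0 < m ^ t := fun t => Real.rpow_pos_of_pos hm t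
      have := hmp (-c)
      refine ⟨h1.trans ?_, h2, h3.trans ?_⟩
      · calc _ = C * 1 * ‖z‖ ^ (-(1 / 2) : ℝ) * m ^ (1 - c) * min (ρ / √‖z‖) 1 *
              Real.exp (-(|y - ρ| ^ 2 / (8 / δ * ‖z‖))) := by ring
          _ ≤ _ := by gcongr; linarith
      · rw [hp]
        calc _ = C * (1 - c + m * m) * ‖z‖⁻¹ * m ^ (-c) * min (ρ / √‖z‖) 1 *
              Real.exp (-(|y - ρ| ^ 2 / (8 / δ * ‖z‖))) := by field_simp
          _ ≤ _ := by gcongr; nlinarith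
    · exact ⟨1, one_pos, fun _ _ _ _ _ _ h => absurd h hc⟩
  -- For `ν = (c - 1) / 2` the exponent of `y` is zero, so the term with `1 / y` is absent from the
  -- derivative.
  have hn : ∃ C > 0, ∀ z ∈ sector (Real.pi / 2 - ε), ∀ y ρ : ℝ, 0 < y → 0 < ρ → -1 < c →
      ‖heatKernelNeumann c z y ρ‖ ≤
        C * ‖z‖ ^ (-(1 / 2) : ℝ) * (min (ρ / √‖z‖) 1) ^ c *
          Real.exp (-(|y - ρ| ^ 2 / (8 / δ * ‖z‖))) ∧
      DifferentiableAt ℝ (fun t : ℝ => heatKernelNeumann c z t ρ) y ∧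
      ‖deriv (fun t : ℝ => heatKernelNeumann c z t ρ) y‖ ≤
        C * ‖z‖⁻¹ * min (y / √‖z‖) 1 * (min (ρ / √‖z‖) 1) ^ c *
          Real.exp (-(|y - ρ| ^ 2 / (8 / δ * ‖z‖))) := by
    by_cases hc : -1 < c
    · obtain ⟨C, hC, h⟩ := exists_besselHeatKernel_bounds hδ hδ1 (ν := (c - 1) / 2)
        (by linarith) c
      refine ⟨C, hC, fun z hz y ρ hy hρ _ => ?_⟩
      obtain ⟨hz0, hzδ⟩ := hsec z hz
      obtain ⟨h1, h2, h3⟩ := h z hz0 hzδ y ρ hy hρ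
      rw [show (1 + c) / 2 + (c - 1) / 2 = c by ring, show (1 - c) / 2 + (c - 1) / 2 = 0 by ring,
        Real.rpow_zero, hκ z hz0] at h1 h3
      rw [abs_zero, zero_div, zero_add] at h3
      exact ⟨h1.trans_eq (by ring), h2, h3.trans_eq (by ring)⟩
    · exact ⟨1, one_pos, fun _ _ _ _ _ _ h => absurd h hc⟩
  obtain ⟨C₁, hC₁, hd⟩ := hd
  obtain ⟨C₂, hC₂, hn⟩ := hn
  have hmin : ∀ (z : ℂ) (x : ℝ), 0 < x → 0 ≤ min (x / √‖z‖) 1 := fun z x hx =>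
    le_min (by positivity) zero_le_one
  refine ⟨⟨C₁ + C₂, by positivity, 8 / δ, by positivity, fun z hz y ρ hy hρ =>
    ⟨fun hc => (hd z hz y ρ hy hρ hc).1.trans ?_, fun hc => (hn z hz y ρ hy hρ hc).1.trans ?_⟩⟩,
    ⟨C₁ + C₂, by positivity, 8 / δ, by positivity, fun z hz y ρ hy hρ =>
    ⟨fun hc => ⟨(hd z hz y ρ hy hρ hc).2.1, (hd z hz y ρ hy hρ hc).2.2.trans ?_⟩,
      fun hc => ⟨(hn z hz y ρ hy hρ hc).2.1, (hn z hz y ρ hy hρ hc).2.2.trans ?_⟩⟩⟩⟩ <;>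
  · have := hmin z y hy
    have := hmin z ρ hρ
    gcongr
    linarith
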